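/- Let $0<\nu<1$ and $\mu=1-\nu$. For each $N$, let $(X_N(t))_{t\ge 0}$ be the Engset process with $N$ sources and capacity $C_N=N$ (equivalently, the Ehrenfest process with $N$ particles), that is, the right-continuous continuous-time Markov jump process on $\{0,1,\dots,N\}$ with $Q$-matrix given by $$q(x,x+1)=\nu\,(N-x)\quad (0\le x<N),\qquad q(x,x-1)=\mu\,x\quad (0<x\le N),$$ all other off-diagonal entries being $0$, started at $X_N(0)=0$. (In the Ehrenfest urn, each of $N$ particles in two boxes $0$ and $1$ jumps independently from box $0$ to box $1$ at rate $\nu$ and from box $1$ to box $0$ at rate $\mu$, and $X_N(t)$ is the number of particles in box $1$ at time $t$.) Let $$T_N=\inf\{s\ge 0: X_N(s)=N\};$$ this is the time at which, for the first time, all particles, initially all in box $0$, are in box $1$. Then, for each $N$, $T_N$ is almost surely finite, and, as $N\to\infty$, the random variables $N\nu^N T_N$ converge in distribution to an exponentially distributed random variable with parameter (rate) $1-\nu$, i.e. with mean $1/(1-\nu)$. -/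

import Mathlib

open MeasureTheory ProbabilityTheory Filter Topology
open scoped NNReal

/-- A continuous-time Markov jump process on a finite state space `S` with `Q`-matrix `Q`:
its paths are almost surely right-continuous for the discrete topology on `S`, and it is a
Markov process with transition semigroup `t ↦ exp (t Q)`, i.e. for all times `t₀ ≤ … ≤ tₙ` and
states `x₀, …, xₙ`,
`P(X(t₀) = x₀, …, X(tₙ) = xₙ) = P(X(t₀) = x₀) ∏ᵢ exp((tᵢ₊₁ - tᵢ) Q)(xᵢ, xᵢ₊₁)`. -/
structure IsMarkovJumpProcess {S Ω : Type*} [Fintype S] [DecidableEq S] [MeasurableSpace S]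
    [MeasurableSpace Ω] (Q : Matrix S S ℝ) (X : ℝ≥0 → Ω → S) (P : Measure Ω) : Prop where
  measurable : ∀ t, Measurable (X t)
  right_continuous : ∀ᵐ ω ∂P, ∀ t, ∀ᶠ s in 𝓝[≥] t, X s ω = X t ω
  markov : ∀ (n : ℕ) (t : Fin (n + 1) → ℝ≥0) (x : Fin (n + 1) → S), Monotone t →
    P.real {ω | ∀ i, X (t i) ω = x i} =
      P.real {ω | X (t 0) ω = x 0} *
        ∏ i : Fin n,
          (NormedSpace.exp (((t i.succ : ℝ) - (t i.castSucc : ℝ)) • Q)) (x i.castSucc) (x i.succ)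

/-- The `Q`-matrix of the Engset process with `N` sources, capacity `C` (with `C ≤ N`), activation
rate `ν` and deactivation rate `μ`: the birth and death process on `{0, …, C}` which jumps
from `x` to `x + 1` at rate `ν (N - x)` if `x < C`, and from `x` to `x - 1` at rate `μ x`. -/
def engsetQ (ν μ : ℝ) (N C : ℕ) : Matrix (Fin (C + 1)) (Fin (C + 1)) ℝ :=
  Matrix.of fun x y =>
    if (y : ℕ) = (x : ℕ) + 1 then ν * ((N : ℝ) - ((x : ℕ) : ℝ))
    else if (x : ℕ) = (y : ℕ) + 1 then μ * ((x : ℕ) : ℝ)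
    else if x = y then
      -(μ * ((x : ℕ) : ℝ) + if (x : ℕ) < C then ν * ((N : ℝ) - ((x : ℕ) : ℝ)) else 0)
    else 0

/-- `X` is an Engset process with `N` sources and capacity `C`, started at `0`, for the rates `ν`
and `μ = 1 - ν` (the time scale being normalized so that `ν + μ = 1`). For `C = N` it is the
Ehrenfest process. -/
structure IsEngsetFromZero {Ω : Type*} [MeasurableSpace Ω] (ν : ℝ) (N C : ℕ)
    (X : ℝ≥0 → Ω → Fin (C + 1)) (P : Measure Ω) : Prop where
  isMarkovJumpProcess : IsMarkovJumpProcess (engsetQ ν (1 - ν) N C) X P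
  initial : ∀ᵐ ω ∂P, X 0 ω = 0

/-- The hitting time `inf {s ≥ 0 | X(s) = C}`, equal to `⊤` if `C` is never reached. -/
noncomputable def capacityHittingTime {Ω : Type*} {C : ℕ} (X : ℝ≥0 → Ω → Fin (C + 1)) :
    Ω → WithTop ℝ≥0 :=
  hittingAfter X {Fin.last C} 0

/-! ### Transition probabilities of the Ehrenfest process -/

section MatrixExp

attribute [local instance] Matrix.linftyOpNormedRing Matrix.linftyOpNormedAlgebra

/-! The particles are independent two-state chains, so the probability of being at `N` at time `t`
is `(ν (1 - e^{-t}))^N` from state `0` and `(ν + (1 - ν) e^{-t})^N` from state `N`. Decomposing at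
the first visit `T` to `N`, the Laplace transform of the first function is `E e^{-αT}` times that of
the second. After multiplication by `α`, the first transform is `ν^N` up to an error `ν^N N |α|`,
because of exponential relaxation to equilibrium, and the second is `R(α) = ∑ p_k α / (α + k)`
(`returnTransform`), where `p_k` are the binomial weights with parameters `N` and `1 - ν`. Hence `|E
e^{-αT} R(α) - ν^N| ≤ ν^N N |α|` for `Re α ≥ 0`.

At `α = 0` this forces `T < ∞` almost surely. At `α = -i t N ν^N` the error relative to `ν^N` is
`|t| N² ν^N → 0`, while `R(α) / ν^N = 1 - i t N ∑_{k ≥ 1} p_k / (α + k)` tends to `1 - i t / (1 -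
ν)`, since `N E[1/K; K ≥ 1] → 1 / (1 - ν)` for `K` binomial. The characteristic functions therefore
converge to that of the exponential law.

No strong Markov property is used: the renewal equation is written for the skeleton `0, h, 2h, …`,
where finite-dimensional laws suffice, generating functions at `w = e^{-αh}` replace Laplace
transforms, and right-continuity allows `h → 0`. -/

theorem Matrix.hasDerivAt_exp_smul_apply {S : Type*} [Fintype S] [DecidableEq S]
    (Q : Matrix S S ℝ) (t : ℝ) (i j : S) :
    HasDerivAt (fun s : ℝ => NormedSpace.exp (s • Q) i j) ((NormedSpace.exp (t • Q) * Q) i j) t :=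
  let L : Matrix S S ℝ →L[ℝ] ℝ := LinearMap.toContinuousLinearMap (Matrix.entryLinearMap ℝ ℝ i j)
  L.hasFDerivAt.comp_hasDerivAt t (hasDerivAt_exp_smul_const (𝕂 := ℝ) Q t)

end MatrixExp

/-- Solutions of the linear differential equation `V' = Q V` are given by the exponential. -/
theorem Matrix.exp_smul_mulVec_eq_of_hasDerivAt {S : Type*} [Fintype S] [DecidableEq S]
    (Q : Matrix S S ℝ) (V : ℝ → S → ℝ)
    (hV : ∀ t i, HasDerivAt (fun s => V s i) ((Q.mulVec (V t)) i) t) (t : ℝ) :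
    (NormedSpace.exp (t • Q)).mulVec (V 0) = V t := by
  -- Variation of constants: `exp (-s Q) V(s)` does not depend on `s`.
  have key : ∀ i, ∀ s : ℝ, HasDerivAt
      (fun s : ℝ => ((NormedSpace.exp ((-s) • Q)).mulVec (V s)) i) 0 s := by
    intro i s
    have h1 : ∀ j, HasDerivAt (fun s : ℝ => NormedSpace.exp ((-s) • Q) i j)
        (-((NormedSpace.exp ((-s) • Q) * Q) i j)) s := by
      intro j
      have := (Matrix.hasDerivAt_exp_smul_apply Q (-s) i j).scomp s (hasDerivAt_neg s)
      simpa [Function.comp_def] using this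
    have h2 := HasDerivAt.fun_sum (u := Finset.univ) (fun j _ => (h1 j).mul (hV s j))
    refine h2.congr_deriv ?_
    rw [Finset.sum_add_distrib]
    have e1 : ∑ j, -((NormedSpace.exp ((-s) • Q) * Q) i j) * V s j
        = -(((NormedSpace.exp ((-s) • Q) * Q).mulVec (V s)) i) := by
      simp [Matrix.mulVec, dotProduct, Finset.sum_neg_distrib]
    have e2 : ∑ j, NormedSpace.exp ((-s) • Q) i j * (Q.mulVec (V s)) j
        = ((NormedSpace.exp ((-s) • Q)).mulVec (Q.mulVec (V s))) i := by
      simp [Matrix.mulVec, dotProduct]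
    rw [e1, e2, Matrix.mulVec_mulVec]
    ring
  have hconst : (NormedSpace.exp ((-t) • Q)).mulVec (V t) = V 0 := by
    ext i
    have := is_const_of_deriv_eq_zero (fun s => (key i s).differentiableAt)
      (fun s => (key i s).deriv) t 0
    simpa using this
  rw [← hconst, Matrix.mulVec_mulVec, ← Matrix.exp_add_of_commute]
  · simp
  · exact ((Commute.refl Q).smul_left t).smul_right (-t)

/-- The probability that the Ehrenfest process started at `x` is at `N` at time `t`. -/
noncomputable def ehrenfestTop (ν : ℝ) (N x : ℕ) (t : ℝ) : ℝ :=
  (ν * (1 - Real.exp (-t))) ^ (N - x) * (ν + (1 - ν) * Real.exp (-t)) ^ x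

/-- Taking `V` on `ℕ` avoids boundary cases: at `x = N` the value `V (N + 1)` and at `x = 0` the
truncated `V (0 - 1)` carry the coefficient `0`. -/
theorem engsetQ_mulVec_apply (ν μ : ℝ) (N : ℕ) (V : ℕ → ℝ) (x : Fin (N + 1)) :
    ((engsetQ ν μ N N).mulVec (fun y => V y)) x =
      ν * ((N : ℝ) - ((x : ℕ) : ℝ)) * (V (x + 1) - V x) +
        μ * ((x : ℕ) : ℝ) * (V ((x : ℕ) - 1) - V x) := by
  have hsum : ((engsetQ ν μ N N).mulVec (fun y => V y)) x = ∑ y ∈ Finset.range (N + 1),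
      ((if y = (x : ℕ) + 1 then ν * ((N : ℝ) - ((x : ℕ) : ℝ)) * V ((x : ℕ) + 1) else 0) +
       (if y = (x : ℕ) - 1 then μ * ((x : ℕ) : ℝ) * V ((x : ℕ) - 1) else 0) +
       (if y = (x : ℕ) then -(μ * ((x : ℕ) : ℝ) + ν * ((N : ℝ) - ((x : ℕ) : ℝ))) * V x
          else 0)) := by
    rw [Finset.sum_range]
    simp only [Matrix.mulVec, dotProduct]
    refine Finset.sum_congr rfl fun y _ => ?_
    have hx := x.2
    have hy := y.2
    have hN : (if (x : ℕ) < N then ν * ((N : ℝ) - ((x : ℕ) : ℝ)) else 0)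
        = ν * ((N : ℝ) - ((x : ℕ) : ℝ)) := by
      split_ifs with h
      · rfl
      · have : (x : ℕ) = N := by omega
        simp [this]
    simp only [engsetQ, Matrix.of_apply, hN]
    by_cases h1 : (y : ℕ) = (x : ℕ) + 1
    · have h2 : ¬ ((y : ℕ) = (x : ℕ) - 1) := by omega
      have h3 : ¬ ((y : ℕ) = (x : ℕ)) := by omega
      rw [if_pos h1, if_pos h1, if_neg h2, if_neg h3, add_zero, add_zero, ← h1]
    · by_cases h2 : (x : ℕ) = (y : ℕ) + 1
      · have h3 : ¬ ((y : ℕ) = (x : ℕ)) := by omega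
        have h4 : (y : ℕ) = (x : ℕ) - 1 := by omega
        have h5 : x ≠ y := fun h => h3 (by rw [h])
        rw [if_neg h1, if_pos h2, if_neg h1, if_pos h4, if_neg h3, ← h4]
        ring
      · by_cases h3 : (y : ℕ) = (x : ℕ)
        · have h4 : x = y := Fin.ext h3.symm
          subst h4
          by_cases h5 : (x : ℕ) = 0
          · simp [h5]
          · have : ¬ ((x : ℕ) = (x : ℕ) - 1) := by omega
            simp [this]
        · have h5 : x ≠ y := fun h => h3 (by rw [h])
          by_cases h6 : (x : ℕ) = 0
          · rw [if_neg h1, if_neg h2, if_neg h5, if_neg h1, if_neg h3]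
            simp [h6]
          · have : ¬ ((y : ℕ) = (x : ℕ) - 1) := by omega
            simp [h1, h2, h3, h5, this]
  rw [hsum, Finset.sum_add_distrib, Finset.sum_add_distrib, Finset.sum_ite_eq',
    Finset.sum_ite_eq', Finset.sum_ite_eq']
  have hx := x.2
  have e1 : (x : ℕ) - 1 < N + 1 := by omega
  simp only [Finset.mem_range, hx, e1, if_true]
  by_cases h : (x : ℕ) + 1 < N + 1
  · simp only [h, if_true]
    ring
  · have : (x : ℕ) = N := by omega
    rw [if_neg h, this]
    ring

/-- This is the backward equation. With `p`, `q` the probabilities that one particle is in box `1`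
when started in box `0`, resp. `1`, one has `p' = ν (q - p)` and `q' = (1 - ν) (p - q)`; the product
rule for `p ^ (N - x) * q ^ x` then moves one particle at a time. -/
theorem hasDerivAt_ehrenfestTop (ν : ℝ) {N x : ℕ} (hx : x ≤ N) (t : ℝ) :
    HasDerivAt (fun s => ehrenfestTop ν N x s)
      (ν * ((N : ℝ) - x) * (ehrenfestTop ν N (x + 1) t - ehrenfestTop ν N x t) +
        (1 - ν) * (x : ℝ) * (ehrenfestTop ν N (x - 1) t - ehrenfestTop ν N x t)) t := by
  obtain ⟨k, rfl⟩ := Nat.exists_eq_add_of_le hx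
  have he : HasDerivAt (fun s : ℝ => Real.exp (-s)) (-Real.exp (-t)) t := by
    simpa using (hasDerivAt_neg t).exp
  have hp : HasDerivAt (fun s : ℝ => ν * (1 - Real.exp (-s))) (ν * Real.exp (-t)) t := by
    simpa using (he.const_sub 1).const_mul ν
  have hq : HasDerivAt (fun s : ℝ => ν + (1 - ν) * Real.exp (-s)) (-(1 - ν) * Real.exp (-t)) t := by
    exact ((he.const_mul (1 - ν)).const_add ν).congr_deriv (by ring)
  have h := (hp.pow k).mul (hq.pow x)
  have hfun : (fun s => ehrenfestTop ν (x + k) x s) =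
      (fun s : ℝ => (ν * (1 - Real.exp (-s))) ^ k * (ν + (1 - ν) * Real.exp (-s)) ^ x) := by
    funext s; simp [ehrenfestTop]
  rw [hfun]
  refine h.congr_deriv ?_
  simp only [ehrenfestTop, Pi.pow_apply]
  set p := ν * (1 - Real.exp (-t)) with hpd
  set q := ν + (1 - ν) * Real.exp (-t) with hqd
  have hpq : Real.exp (-t) = q - p := by rw [hpd, hqd]; ring
  rw [hpq]
  -- The cases separate the exponents affected by truncated subtraction.
  rcases k with _ | k <;> rcases x with _ | x
  · simp
  · have e1 : x + 1 + 0 - (x + 1 + 1) = 0 := by omega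
    have e2 : x + 1 + 0 - (x + 1) = 0 := by omega
    have e3 : x + 1 + 0 - (x + 1 - 1) = 1 := by omega
    simp only [e1, e2, e3]
    push_cast
    simp
    ring
  · have e1 : 0 + (k + 1) - (0 + 1) = k := by omega
    simp only [e1]
    push_cast
    simp
    ring
  · have e1 : x + 1 + (k + 1) - (x + 1 + 1) = k := by omega
    have e2 : x + 1 + (k + 1) - (x + 1) = k + 1 := by omega
    have e3 : x + 1 + (k + 1) - (x + 1 - 1) = k + 2 := by omega
    simp only [e1, e2, e3]
    push_cast
    ring

theorem exp_smul_engsetQ_apply_last (ν : ℝ) (N : ℕ) (t : ℝ) (x : Fin (N + 1)) :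
    NormedSpace.exp (t • engsetQ ν (1 - ν) N N) x (Fin.last N) = ehrenfestTop ν N x t := by
  have h := Matrix.exp_smul_mulVec_eq_of_hasDerivAt (engsetQ ν (1 - ν) N N)
    (fun s y => ehrenfestTop ν N y s) (fun s y => by
      rw [engsetQ_mulVec_apply ν (1 - ν) N (fun k => ehrenfestTop ν N k s)]
      exact hasDerivAt_ehrenfestTop ν (Nat.lt_succ_iff.1 y.2) s) t
  have h0 : (fun y : Fin (N + 1) => ehrenfestTop ν N y 0) = Pi.single (Fin.last N) 1 := by
    funext y
    by_cases hy : y = Fin.last N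
    · subst hy; simp [ehrenfestTop]
    · have : N - (y : ℕ) ≠ 0 := by
        have := y.2
        have : (y : ℕ) ≠ N := fun h => hy (Fin.ext (by simpa using h))
        omega
      simp [ehrenfestTop, hy, this]
  have h1 := congrFun h x
  simp only [h0] at h1
  simpa using h1

/-! ### The renewal equation along a discrete skeleton -/

section Renewal

/-- The event that the process, observed at the times `0, h, 2h, …`, is at `y` for the first time
at time `k h`. -/
def firstHit {S Ω : Type*} (X : ℝ≥0 → Ω → S) (y : S) (h : ℝ≥0) (k : ℕ) : Set Ω :=
  {ω | X (k * h) ω = y ∧ ∀ j < k, X (j * h) ω ≠ y}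

theorem pairwise_disjoint_firstHit {S Ω : Type*} (X : ℝ≥0 → Ω → S) (y : S) (h : ℝ≥0) :
    Pairwise (Function.onFun Disjoint (firstHit X y h)) := by
  intro i j hij
  refine Set.disjoint_left.2 fun ω hi hj => ?_
  rcases lt_or_gt_of_ne hij with hlt | hlt
  · exact hj.2 i hlt hi.1
  · exact hi.2 j hlt hj.1

theorem measurableSet_firstHit {S Ω : Type*} [MeasurableSpace S]
    [MeasurableSingletonClass S] [MeasurableSpace Ω] {X : ℝ≥0 → Ω → S}
    (hX : ∀ t, Measurable (X t)) (y : S) (h : ℝ≥0) (k : ℕ) : MeasurableSet (firstHit X y h k) := by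
  have : firstHit X y h k = (X (k * h) ⁻¹' {y}) ∩ ⋂ j, ⋂ (_ : j < k), (X (j * h) ⁻¹' {y})ᶜ := by
    ext ω; simp [firstHit]
  rw [this]
  exact (hX _ (measurableSet_singleton y)).inter (MeasurableSet.iInter fun j =>
    MeasurableSet.iInter fun _ => (hX _ (measurableSet_singleton y)).compl)

variable {S Ω : Type*} [Fintype S] [DecidableEq S] [MeasurableSpace S] [MeasurableSpace Ω]

/-- Quotient-free form of the Markov property: one more observation contributes one more factor to
the product formula. -/
theorem IsMarkovJumpProcess.measureReal_path_snoc {Q : Matrix S S ℝ} {X : ℝ≥0 → Ω → S}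
    {P : Measure Ω} (hX : IsMarkovJumpProcess Q X P) {n : ℕ} {t : Fin (n + 2) → ℝ≥0}
    (ht : Monotone t) (x : Fin (n + 1) → S) (z : S) :
    P.real {ω | (∀ i : Fin (n + 1), X (t i.castSucc) ω = x i) ∧ X (t (Fin.last _)) ω = z} =
      P.real {ω | ∀ i : Fin (n + 1), X (t i.castSucc) ω = x i} *
        NormedSpace.exp (((t (Fin.last _) : ℝ) - (t (Fin.last n).castSucc : ℝ)) • Q)
          (x (Fin.last n)) z := by
  have h1 := hX.markov (n + 1) t (Fin.snoc (α := fun _ => S) x z) ht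
  have h2 := hX.markov n (fun i => t i.castSucc) x
    (fun i j hij => ht (Fin.castSucc_le_castSucc_iff.2 hij))
  rw [Fin.prod_univ_castSucc] at h1
  have h0 : (Fin.snoc (α := fun _ => S) x z : Fin (n + 2) → S) 0 = x 0 := by
    rw [← Fin.castSucc_zero, Fin.snoc_castSucc]
  simp only [Fin.forall_fin_succ', Fin.snoc_castSucc, Fin.snoc_last, h0, Fin.succ_castSucc,
    Fin.succ_last] at h1
  rw [h2, Fin.castSucc_zero, mul_assoc, ← h1]
  simp only [Fin.forall_fin_succ']

theorem IsMarkovJumpProcess.measureReal_of_ae_eq_zero {Q : Matrix S S ℝ} {X : ℝ≥0 → Ω → S}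
    {P : Measure Ω} [IsProbabilityMeasure P] (hX : IsMarkovJumpProcess Q X P) {x : S}
    (h0 : ∀ᵐ ω ∂P, X 0 ω = x) (y : S) (t : ℝ≥0) :
    P.real {ω | X t ω = y} = NormedSpace.exp ((t : ℝ) • Q) x y := by
  have h := hX.markov 1 ![0, t] ![x, y] (Fin.monotone_iff_le_succ.2 fun i => by
    fin_cases i; simp)
  have e1 : P.real {ω | X 0 ω = x} = 1 := by
    rw [← probReal_univ (μ := P)]
    refine measureReal_congr (eventuallyEq_set.2 ?_)
    filter_upwards [h0] with ω hω
    simp [hω]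
  have e2 : P.real {ω | X t ω = y} = P.real {ω | ∀ i : Fin 2, X (![0, t] i) ω = ![x, y] i} := by
    refine measureReal_congr (eventuallyEq_set.2 ?_)
    filter_upwards [h0] with ω hω
    simp [hω]
  rw [e2, h]
  simp [e1]

variable [MeasurableSingletonClass S]

/-- As `S` is finite, the past event splits into finitely many cylinders; all of them end at `y`, so
they share the same last factor. -/
theorem IsMarkovJumpProcess.measureReal_inter_eq_mul {Q : Matrix S S ℝ} {X : ℝ≥0 → Ω → S}
    {P : Measure Ω} [IsFiniteMeasure P] (hX : IsMarkovJumpProcess Q X P) {n : ℕ}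
    {t : Fin (n + 2) → ℝ≥0} (ht : Monotone t) (A : Set (Fin (n + 1) → S)) (y z : S)
    (hA : ∀ x ∈ A, x (Fin.last n) = y) :
    P.real {ω | (fun i : Fin (n + 1) => X (t i.castSucc) ω) ∈ A ∧ X (t (Fin.last _)) ω = z} =
      P.real {ω | (fun i : Fin (n + 1) => X (t i.castSucc) ω) ∈ A} *
        NormedSpace.exp (((t (Fin.last _) : ℝ) - (t (Fin.last n).castSucc : ℝ)) • Q) y z := by
  classical
  set f : Ω → Fin (n + 1) → S := fun ω i => X (t i.castSucc) ω with hf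
  have hfm : Measurable f := measurable_pi_lambda _ fun i => hX.measurable _
  set g : Ω → (Fin (n + 1) → S) × S := fun ω => (f ω, X (t (Fin.last _)) ω) with hg
  have hgm : Measurable g := hfm.prodMk (hX.measurable _)
  have e1 := sum_measureReal_preimage_singleton (μ := P) A.toFinset (f := f)
    (fun y _ => hfm (measurableSet_singleton y))
  have e2 := sum_measureReal_preimage_singleton (μ := P) (A.toFinset ×ˢ {z}) (f := g)
    (fun y _ => hgm (measurableSet_singleton y))
  have s1 : {ω | f ω ∈ A} = f ⁻¹' (A.toFinset : Set (Fin (n + 1) → S)) := by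
    ext ω; simp
  have s2 : {ω | f ω ∈ A ∧ X (t (Fin.last _)) ω = z} =
      g ⁻¹' ((A.toFinset ×ˢ {z} : Finset ((Fin (n + 1) → S) × S)) :
        Set ((Fin (n + 1) → S) × S)) := by
    ext ω; simp [hg, eq_comm]
  rw [s1, s2, ← e1, ← e2, Finset.sum_product, Finset.sum_mul]
  refine Finset.sum_congr rfl fun x hx => ?_
  have h := hX.measureReal_path_snoc ht x z
  rw [hA x (by simpa using hx)] at h
  have s3 : {ω | ∀ i : Fin (n + 1), X (t i.castSucc) ω = x i} = f ⁻¹' {x} := by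
    ext ω; simp [hf, funext_iff]
  have s4 : {ω | (∀ i : Fin (n + 1), X (t i.castSucc) ω = x i) ∧ X (t (Fin.last _)) ω = z} =
      g ⁻¹' {(x, z)} := by
    ext ω; simp [hg, hf, funext_iff]
  rw [s3, s4] at h
  simpa using h

theorem IsMarkovJumpProcess.measureReal_firstHit_inter {Q : Matrix S S ℝ} {X : ℝ≥0 → Ω → S}
    {P : Measure Ω} [IsFiniteMeasure P] (hX : IsMarkovJumpProcess Q X P) (y z : S) (h : ℝ≥0)
    {k n : ℕ} (hkn : k ≤ n) :
    P.real (firstHit X y h k ∩ {ω | X (n * h) ω = z}) =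
      P.real (firstHit X y h k) * NormedSpace.exp (((n - k : ℕ) * (h : ℝ)) • Q) y z := by
  -- The times `0, h, …, k h` followed by `n h`; for `n = k` the last time is repeated, which
  -- monotonicity permits.
  let t : Fin (k + 2) → ℝ≥0 := Fin.snoc (α := fun _ => ℝ≥0) (fun i : Fin (k + 1) => (i : ℕ) * h)
    (n * h)
  have tc : ∀ i : Fin (k + 1), t i.castSucc = (i : ℕ) * h := fun i => by
    simp only [t, Fin.snoc_castSucc]
  have tl : t (Fin.last _) = n * h := by simp only [t, Fin.snoc_last]
  have ht : Monotone t := by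
    refine Fin.monotone_iff_le_succ.2 fun i => ?_
    rw [tc]
    refine Fin.lastCases ?_ (fun i => ?_) i
    · rw [Fin.succ_last, tl, Fin.val_last]
      gcongr
    · rw [← Fin.castSucc_succ, tc]
      gcongr
      simp
  have key := hX.measureReal_inter_eq_mul ht
    {x | x (Fin.last k) = y ∧ ∀ j, j ≠ Fin.last k → x j ≠ y} y z (fun x hx => hx.1)
  simp only [tc, tl, Fin.val_last] at key
  have s1 : firstHit X y h k = {ω | (fun i : Fin (k + 1) => X ((i : ℕ) * h) ω) ∈
      {x : Fin (k + 1) → S | x (Fin.last k) = y ∧ ∀ j, j ≠ Fin.last k → x j ≠ y}} := by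
    ext ω
    simp only [firstHit, Set.mem_ofPred_eq, Fin.val_last]
    refine and_congr_right fun _ => ⟨fun H j hj => H j ?_, fun H j hj => ?_⟩
    · exact Fin.val_lt_last hj
    · exact H ⟨j, by omega⟩ (fun e => by simp [Fin.ext_iff] at e; omega)
  have e : ((n * h : ℝ≥0) : ℝ) - ((k * h : ℝ≥0) : ℝ) = (n - k : ℕ) * (h : ℝ) := by
    push_cast [Nat.cast_sub hkn]; ring
  rw [e] at key
  rw [s1]
  exact key

/-- The renewal equation for the process observed at the times `0, h, 2h, …`. -/
theorem IsMarkovJumpProcess.renewal {Q : Matrix S S ℝ} {X : ℝ≥0 → Ω → S}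
    {P : Measure Ω} [IsFiniteMeasure P] (hX : IsMarkovJumpProcess Q X P) (y : S) (h : ℝ≥0)
    (n : ℕ) :
    P.real {ω | X (n * h) ω = y} = ∑ k ∈ Finset.range (n + 1),
      P.real (firstHit X y h k) * NormedSpace.exp (((n - k : ℕ) * (h : ℝ)) • Q) y y := by
  have hU : {ω | X (n * h) ω = y} =
      ⋃ k ∈ Finset.range (n + 1), firstHit X y h k ∩ {ω | X (n * h) ω = y} := by
    ext ω
    simp only [Set.mem_ofPred_eq, Set.mem_iUnion, Set.mem_inter_iff, Finset.mem_range, exists_prop]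
    refine ⟨fun H => ?_, fun ⟨_, _, _, H⟩ => H⟩
    classical
    have hex : ∃ k : ℕ, X (k * h) ω = y := ⟨n, H⟩
    exact ⟨Nat.find hex, Nat.lt_succ_of_le (Nat.find_min' hex H),
      ⟨Nat.find_spec hex, fun j hj => Nat.find_min hex hj⟩, H⟩
  have hm : MeasurableSet {ω | X (n * h) ω = y} := hX.measurable _ (measurableSet_singleton y)
  rw [hU, measureReal_biUnion_finset]
  · exact Finset.sum_congr rfl fun k hk =>
      hX.measureReal_firstHit_inter y y h (Nat.lt_succ_iff.1 (Finset.mem_range.1 hk))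
  · intro i _ j _ hij
    exact (pairwise_disjoint_firstHit X y h hij).mono Set.inter_subset_left Set.inter_subset_left
  · exact fun k _ => (measurableSet_firstHit hX.measurable y h k).inter hm

end Renewal

/-! ### Generating functions -/

theorem summable_norm_ofReal_mul_pow {a : ℕ → ℝ} (ha : ∀ n, |a n| ≤ 1) {w : ℂ} (hw : ‖w‖ < 1) :
    Summable fun n => ‖(a n : ℂ) * w ^ n‖ := by
  refine Summable.of_nonneg_of_le (fun n => norm_nonneg _) (fun n => ?_)
    (summable_geometric_of_lt_one (norm_nonneg w) hw)
  rw [norm_mul, norm_pow, Complex.norm_real, Real.norm_eq_abs]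
  exact mul_le_of_le_one_left (by positivity) (ha n)

/-- The renewal equation is a convolution, hence a Cauchy product. -/
theorem tsum_mul_tsum_of_renewal {a b f : ℕ → ℝ} (hb : ∀ n, |b n| ≤ 1) (hf : ∀ n, |f n| ≤ 1)
    (h : ∀ n, a n = ∑ k ∈ Finset.range (n + 1), f k * b (n - k)) {w : ℂ} (hw : ‖w‖ < 1) :
    (∑' n, (f n : ℂ) * w ^ n) * (∑' n, (b n : ℂ) * w ^ n) = ∑' n, (a n : ℂ) * w ^ n := by
  rw [tsum_mul_tsum_eq_tsum_sum_range_of_summable_norm (summable_norm_ofReal_mul_pow hf hw)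
    (summable_norm_ofReal_mul_pow hb hw)]
  refine tsum_congr fun n => ?_
  rw [h n]
  push_cast
  rw [Finset.sum_mul]
  refine Finset.sum_congr rfl fun k hk => ?_
  have : w ^ n = w ^ k * w ^ (n - k) := by
    rw [← pow_add, Nat.add_sub_cancel' (Nat.lt_succ_iff.1 (Finset.mem_range.1 hk))]
  rw [this]
  ring

/-- If the coefficients were all equal to their limit `ν ^ N`, the difference would vanish. By
Bernoulli's inequality the deficit of the `n`th one is at most `ν ^ N * N * x ^ n`, which is
summable uniformly in `w`. -/
theorem norm_one_sub_mul_tsum_sub_le {ν x : ℝ} (hν0 : 0 ≤ ν) (hν1 : ν ≤ 1) (hx0 : 0 ≤ x)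
    (hx1 : x < 1) (N : ℕ) {w : ℂ} (hw : ‖w‖ < 1) :
    ‖(1 - w) * (∑' n, (((ν * (1 - x ^ n)) ^ N : ℝ) : ℂ) * w ^ n) - (ν ^ N : ℝ)‖ ≤
      ν ^ N * N * ‖1 - w‖ / (1 - x) := by
  have hxn : ∀ n : ℕ, 0 ≤ x ^ n ∧ x ^ n ≤ 1 := fun n => ⟨pow_nonneg hx0 n, pow_le_one₀ hx0 hx1.le⟩
  have h1 : ∀ n : ℕ, 0 ≤ (ν * (1 - x ^ n)) ^ N ∧ (ν * (1 - x ^ n)) ^ N ≤ ν ^ N := fun n =>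
    ⟨pow_nonneg (mul_nonneg hν0 (by linarith [hxn n])) _,
      pow_le_pow_left₀ (mul_nonneg hν0 (by linarith [hxn n]))
        (mul_le_of_le_one_right hν0 (by linarith [hxn n])) _⟩
  have h2 : ∀ n : ℕ, ν ^ N - (ν * (1 - x ^ n)) ^ N ≤ ν ^ N * N * x ^ n := fun n => by
    have := one_add_mul_le_pow (a := -x ^ n) (by linarith [hxn n]) N
    rw [mul_pow, show (1 - x ^ n : ℝ) = 1 + -x ^ n by ring]
    nlinarith [pow_nonneg hν0 N]
  have hν : ν ^ N ≤ 1 := pow_le_one₀ hν0 hν1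
  have s1 : Summable fun n => (((ν * (1 - x ^ n)) ^ N : ℝ) : ℂ) * w ^ n :=
    (summable_norm_ofReal_mul_pow (fun n => abs_le.2 ⟨by linarith [(h1 n).1],
      by linarith [(h1 n).2]⟩) hw).of_norm
  have s2 : Summable fun n => ((ν ^ N : ℝ) : ℂ) * w ^ n :=
    (summable_geometric_of_norm_lt_one hw).mul_left _
  have hw1 : 1 - w ≠ 0 := fun h => by
    have : w = 1 := (sub_eq_zero.1 h).symm
    simp [this] at hw
  have e : (1 - w) * (∑' n, (((ν * (1 - x ^ n)) ^ N : ℝ) : ℂ) * w ^ n) - (ν ^ N : ℝ) =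
      -((1 - w) * ∑' n, ((ν ^ N - (ν * (1 - x ^ n)) ^ N : ℝ) : ℂ) * w ^ n) := by
    have : ∑' n, ((ν ^ N - (ν * (1 - x ^ n)) ^ N : ℝ) : ℂ) * w ^ n =
        (ν ^ N : ℝ) * (1 - w)⁻¹ - ∑' n, (((ν * (1 - x ^ n)) ^ N : ℝ) : ℂ) * w ^ n := by
      rw [← tsum_geometric_of_norm_lt_one hw, ← tsum_mul_left, ← s2.tsum_sub s1]
      refine tsum_congr fun n => ?_
      push_cast
      ring
    rw [this]
    field_simp
    ring
  rw [e, norm_neg, norm_mul]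
  have hg : HasSum (fun n => ν ^ N * N * x ^ n) (ν ^ N * N * (1 - x)⁻¹) :=
    (hasSum_geometric_of_lt_one hx0 hx1).mul_left _
  have hb := tsum_of_norm_bounded hg (f := fun n =>
    ((ν ^ N - (ν * (1 - x ^ n)) ^ N : ℝ) : ℂ) * w ^ n) (fun n => by
      rw [norm_mul, norm_pow, Complex.norm_real, Real.norm_eq_abs,
        abs_of_nonneg (by linarith [h1 n])]
      exact (mul_le_of_le_one_right (by linarith [h1 n])
        (pow_le_one₀ (norm_nonneg _) hw.le)).trans (h2 n))
  calc ‖1 - w‖ * _ ≤ ‖1 - w‖ * (ν ^ N * N * (1 - x)⁻¹) := by gcongr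
    _ = _ := by rw [div_eq_mul_inv]; ring

/-- Binomial expansion gives a sum of geometric series; the factor `1 - w` cancels the pole at `w =
1` of the term `k = 0`. -/
theorem one_sub_mul_tsum_add_pow {ν μ x : ℝ} (hx0 : 0 ≤ x) (hx1 : x ≤ 1) (N : ℕ) {w : ℂ}
    (hw : ‖w‖ < 1) :
    (1 - w) * (∑' n, (((ν + μ * x ^ n) ^ N : ℝ) : ℂ) * w ^ n) =
      ∑ k ∈ Finset.range (N + 1), (μ ^ k * ν ^ (N - k) * N.choose k : ℝ) *
        ((1 - w) / (1 - w * x ^ k)) := by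
  have hs : ∀ (k : ℕ) (c : ℂ), HasSum (fun n : ℕ => c * (w * x ^ k) ^ n)
      (c * (1 - w * x ^ k)⁻¹) := fun k c => by
    refine (hasSum_geometric_of_norm_lt_one ?_).mul_left c
    rw [norm_mul, norm_pow, Complex.norm_real, Real.norm_eq_abs, abs_of_nonneg hx0]
    exact (mul_le_of_le_one_right (norm_nonneg _) (pow_le_one₀ hx0 hx1)).trans_lt hw
  have h := hasSum_sum (s := Finset.range (N + 1)) fun k _ =>
    hs k ((μ ^ k * ν ^ (N - k) * N.choose k : ℝ) : ℂ)
  have e : (fun n : ℕ => (((ν + μ * x ^ n) ^ N : ℝ) : ℂ) * w ^ n) = fun n : ℕ =>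
      ∑ k ∈ Finset.range (N + 1), ((μ ^ k * ν ^ (N - k) * N.choose k : ℝ) : ℂ) *
        (w * x ^ k) ^ n := by
    funext n
    rw [add_comm ν, add_pow]
    push_cast
    rw [Finset.sum_mul]
    refine Finset.sum_congr rfl fun k _ => ?_
    rw [mul_pow, mul_pow, ← pow_mul, ← pow_mul, mul_comm n k]
    ring
  rw [e, h.tsum_eq, Finset.mul_sum]
  refine Finset.sum_congr rfl fun k _ => ?_
  rw [div_eq_mul_inv]
  ring

theorem norm_tsum_mul_sub_le_of_renewal {ν x : ℝ} (hν0 : 0 ≤ ν) (hν1 : ν ≤ 1) (hx0 : 0 ≤ x)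
    (hx1 : x < 1) (N : ℕ) {f : ℕ → ℝ} (hf : ∀ n, |f n| ≤ 1)
    (h : ∀ n, (ν * (1 - x ^ n)) ^ N =
      ∑ k ∈ Finset.range (n + 1), f k * (ν + (1 - ν) * x ^ (n - k)) ^ N)
    {w : ℂ} (hw : ‖w‖ < 1) :
    ‖(∑' n, (f n : ℂ) * w ^ n) * (∑ k ∈ Finset.range (N + 1),
        ((1 - ν) ^ k * ν ^ (N - k) * N.choose k : ℝ) * ((1 - w) / (1 - w * x ^ k))) -
        (ν ^ N : ℝ)‖ ≤ ν ^ N * N * ‖1 - w‖ / (1 - x) := by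
  have hb : ∀ n : ℕ, |(ν + (1 - ν) * x ^ n) ^ N| ≤ 1 := fun n => by
    have h0 : 0 ≤ x ^ n := pow_nonneg hx0 n
    have h1 : x ^ n ≤ 1 := pow_le_one₀ hx0 hx1.le
    have h2 : 0 ≤ ν + (1 - ν) * x ^ n := by nlinarith
    rw [abs_of_nonneg (pow_nonneg h2 _)]
    exact pow_le_one₀ h2 (by nlinarith)
  have key := tsum_mul_tsum_of_renewal (b := fun n => (ν + (1 - ν) * x ^ n) ^ N) hb hf h hw
  rw [← one_sub_mul_tsum_add_pow hx0 hx1.le N hw, mul_left_comm, key]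
  exact norm_one_sub_mul_tsum_sub_le hν0 hν1 hx0 hx1 N hw

/-! ### Approximation of the hitting time along a skeleton -/

/-- The index of the first visit of the skeleton `X 0, X h, X (2h), …` to `y`, equal to `0` if there
is none. -/
noncomputable def skeletonHit {S Ω : Type*} (X : ℝ≥0 → Ω → S) (y : S) (h : ℝ≥0) (ω : Ω) : ℕ :=
  sInf {k : ℕ | X (k * h) ω = y}

theorem skeletonHit_eq_of_mem {S Ω : Type*} {X : ℝ≥0 → Ω → S} {y : S} {h : ℝ≥0} {k : ℕ} {ω : Ω}
    (hω : ω ∈ firstHit X y h k) : skeletonHit X y h ω = k :=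
  le_antisymm (Nat.sInf_le hω.1) (le_csInf ⟨k, hω.1⟩ fun j hj => by
    by_contra hlt
    exact hω.2 j (not_le.1 hlt) hj)

theorem mem_iUnion_firstHit {S Ω : Type*} {X : ℝ≥0 → Ω → S} {y : S} {h : ℝ≥0} {ω : Ω} :
    ω ∈ ⋃ k, firstHit X y h k ↔ ∃ k : ℕ, X (k * h) ω = y := by
  classical
  refine ⟨fun hω => ?_, fun hex => ?_⟩
  · obtain ⟨k, hk⟩ := Set.mem_iUnion.1 hω
    exact ⟨k, hk.1⟩
  · exact Set.mem_iUnion.2 ⟨Nat.find hex, Nat.find_spec hex, fun j hj => Nat.find_min hex hj⟩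

theorem measurable_skeletonHit {S Ω : Type*} [MeasurableSpace S] [MeasurableSingletonClass S]
    [MeasurableSpace Ω] {X : ℝ≥0 → Ω → S} (hX : ∀ t, Measurable (X t)) (y : S) (h : ℝ≥0) :
    Measurable (skeletonHit X y h) := by
  have hU : MeasurableSet (⋃ k, firstHit X y h k) :=
    MeasurableSet.iUnion fun k => measurableSet_firstHit hX y h k
  refine measurable_to_countable' fun k => ?_
  -- The fibre over `0` also contains the paths whose skeleton never visits `y`.
  have : skeletonHit X y h ⁻¹' {k} =
      firstHit X y h k ∪ ((⋃ k, firstHit X y h k)ᶜ ∩ {_ω | k = 0}) := by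
    ext ω
    by_cases hω : ω ∈ ⋃ k, firstHit X y h k
    · obtain ⟨j, hj⟩ := Set.mem_iUnion.1 hω
      have e := skeletonHit_eq_of_mem hj
      simp only [Set.mem_preimage, Set.mem_singleton_iff, Set.mem_union, Set.mem_inter_iff,
        Set.mem_compl_iff, hω, not_true, false_and, or_false, e]
      refine ⟨fun h => h ▸ hj, fun hk => ?_⟩
      rw [← e, skeletonHit_eq_of_mem hk]
    · have e : skeletonHit X y h ω = 0 := by
        have : {k : ℕ | X (k * h) ω = y} = ∅ := by
          by_contra hne
          exact hω (mem_iUnion_firstHit.2 (Set.nonempty_iff_ne_empty.2 hne))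
        simp [skeletonHit, this]
      have hk : ω ∉ firstHit X y h k := fun hk => hω (Set.mem_iUnion.2 ⟨k, hk⟩)
      simp only [Set.mem_preimage, Set.mem_singleton_iff, Set.mem_union, Set.mem_inter_iff,
        Set.mem_compl_iff, hω, not_false_iff, true_and, e, hk, false_or, Set.mem_ofPred_eq]
      exact eq_comm
  rw [this]
  exact (measurableSet_firstHit hX y h k).union (hU.compl.inter (MeasurableSet.const _))

theorem capacityHittingTime_eq_top_iff {Ω : Type*} {C : ℕ} {X : ℝ≥0 → Ω → Fin (C + 1)} {ω : Ω} :
    capacityHittingTime X ω = ⊤ ↔ ∀ t, X t ω ≠ Fin.last C := by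
  classical
  simp only [capacityHittingTime, hittingAfter]
  split_ifs with h
  · obtain ⟨j, -, hj⟩ := h
    exact ⟨fun h => absurd h (WithTop.coe_ne_top), fun h => absurd hj (h j)⟩
  · simp only [true_iff]
    exact fun t ht => h ⟨t, zero_le, ht⟩

/-- Along a path which is right-continuous, the hitting time is approximated by the hitting time of
a skeleton of small mesh. -/
theorem exists_skeletonHit_mul_mem_Icc {Ω : Type*} {C : ℕ} {X : ℝ≥0 → Ω → Fin (C + 1)} {ω : Ω}
    (hr : ∀ t, ∀ᶠ s in 𝓝[≥] t, X s ω = X t ω) (hT : capacityHittingTime X ω ≠ ⊤) :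
    ∃ ε > 0, ∀ h : ℝ≥0, 0 < h → h < ε → ω ∈ ⋃ k, firstHit X (Fin.last C) h k ∧
      (capacityHittingTime X ω).untopD 0 ≤ skeletonHit X (Fin.last C) h ω * h ∧
      skeletonHit X (Fin.last C) h ω * h ≤ (capacityHittingTime X ω).untopD 0 + h := by
  classical
  have hex : ∃ j, X j ω = Fin.last C := by
    by_contra hne
    exact hT (capacityHittingTime_eq_top_iff.2 fun t ht => hne ⟨t, ht⟩)
  set A : Set ℝ≥0 := {i | X i ω = Fin.last C} with hA
  have hAne : A.Nonempty := hex
  have hval : (capacityHittingTime X ω).untopD 0 = sInf A := by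
    have : ∃ j, (0 : ℝ≥0) ≤ j ∧ X j ω ∈ ({Fin.last C} : Set (Fin (C + 1))) := by
      obtain ⟨j, hj⟩ := hex
      exact ⟨j, zero_le, hj⟩
    simp only [capacityHittingTime, hittingAfter, if_pos this, WithTop.untopD_coe]
    simp [hA]
  rw [hval]
  set T := sInf A
  -- The path is constant on `[T, b)`. Hence the infimum is attained, and every skeleton point in
  -- `[T, b)` is a visit; a mesh below `b - T` guarantees one in `[T, T + h]`.
  obtain ⟨b, hb, hbT⟩ := mem_nhdsGE_iff_exists_Ico_subset.1 (hr T)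
  have hTA : T ∈ A := by
    obtain ⟨a, ha, hab⟩ := exists_lt_of_csInf_lt hAne (show sInf A < b from hb)
    have h1 : X a ω = X T ω := hbT ⟨csInf_le (OrderBot.bddBelow A) ha, hab⟩
    exact h1.symm.trans ha
  refine ⟨b - T, tsub_pos_of_lt hb, fun h h0 hh => ?_⟩
  have hlt : T + h < b := by rwa [lt_tsub_iff_left] at hh
  set k := ⌈T / h⌉₊
  have hk1 : T ≤ k * h := by
    have := Nat.le_ceil (T / h)
    rwa [div_le_iff₀ h0] at this
  have hk2 : k * h ≤ T + h := by
    have := (Nat.ceil_lt_add_one (zero_le (a := T / h))).le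
    calc (k : ℝ≥0) * h ≤ (T / h + 1) * h := by gcongr
      _ = T + h := by rw [add_mul, div_mul_cancel₀ _ h0.ne', one_mul]
  have hkA : X (k * h) ω = Fin.last C :=
    (show X (k * h) ω = X T ω from hbT ⟨hk1, hk2.trans_lt hlt⟩).trans hTA
  refine ⟨mem_iUnion_firstHit.2 ⟨k, hkA⟩, ?_, ?_⟩
  · exact csInf_le (OrderBot.bddBelow A)
      (Nat.sInf_mem (s := {k : ℕ | X (k * h) ω = Fin.last C}) ⟨k, hkA⟩)
  · refine le_trans ?_ hk2
    have : skeletonHit X (Fin.last C) h ω ≤ k := Nat.sInf_le hkA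
    gcongr

/-- The mesh `1 / (m + 1)`. -/
noncomputable def mesh (m : ℕ) : ℝ≥0 := 1 / ((m : ℝ≥0) + 1)

theorem mesh_pos (m : ℕ) : 0 < mesh m := by unfold mesh; positivity

theorem tendsto_mesh : Tendsto mesh atTop (𝓝 0) := tendsto_one_div_add_atTop_nhds_zero_nat

theorem tendsto_coe_mesh : Tendsto (fun m => (mesh m : ℝ)) atTop (𝓝[>] 0) :=
  tendsto_nhdsWithin_iff.2 ⟨NNReal.tendsto_coe.2 tendsto_mesh,
    Eventually.of_forall fun m => NNReal.coe_pos.2 (mesh_pos m)⟩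

theorem tendsto_skeletonHit_mul_mesh {Ω : Type*} {C : ℕ} {X : ℝ≥0 → Ω → Fin (C + 1)} {ω : Ω}
    (hr : ∀ t, ∀ᶠ s in 𝓝[≥] t, X s ω = X t ω) :
    Tendsto (fun m => skeletonHit X (Fin.last C) (mesh m) ω * mesh m) atTop
      (𝓝 ((capacityHittingTime X ω).untopD 0)) := by
  by_cases hT : capacityHittingTime X ω = ⊤
  · have : ∀ h, skeletonHit X (Fin.last C) h ω = 0 := fun h => by
      have : {k : ℕ | X (k * h) ω = Fin.last C} = ∅ :=
        Set.eq_empty_iff_forall_notMem.2 fun k => capacityHittingTime_eq_top_iff.1 hT _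
      simp [skeletonHit, this]
    simp [this, hT]
  · obtain ⟨ε, hε, H⟩ := exists_skeletonHit_mul_mem_Icc hr hT
    have hev : ∀ᶠ m in atTop, mesh m < ε := tendsto_mesh.eventually (gt_mem_nhds hε)
    refine tendsto_of_tendsto_of_tendsto_of_le_of_le' tendsto_const_nhds
      (by simpa using tendsto_mesh.const_add ((capacityHittingTime X ω).untopD 0)) ?_ ?_
    · filter_upwards [hev] with m hm using (H _ (mesh_pos m) hm).2.1
    · filter_upwards [hev] with m hm using (H _ (mesh_pos m) hm).2.2

theorem aemeasurable_capacityHittingTime {Ω : Type*} [MeasurableSpace Ω] {P : Measure Ω} {C : ℕ}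
    {Q : Matrix (Fin (C + 1)) (Fin (C + 1)) ℝ} {X : ℝ≥0 → Ω → Fin (C + 1)}
    (hX : IsMarkovJumpProcess Q X P) :
    AEMeasurable (fun ω => (capacityHittingTime X ω).untopD 0) P := by
  refine aemeasurable_of_tendsto_metrizable_ae atTop
    (f := fun m ω => skeletonHit X (Fin.last C) (mesh m) ω * mesh m) (fun m => ?_) ?_
  · have h1 := measurable_skeletonHit hX.measurable (Fin.last C) (mesh m)
    have h2 : Measurable fun n : ℕ => (n : ℝ≥0) * mesh m := measurable_from_nat
    exact (h2.comp h1).aemeasurable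
  · filter_upwards [hX.right_continuous] with ω hω using tendsto_skeletonHit_mul_mesh hω

/-- The function `exp (-α T)`, where `T` is the hitting time, set to `0` where `T = ∞`. -/
noncomputable def expNegHitting {Ω : Type*} {C : ℕ} (X : ℝ≥0 → Ω → Fin (C + 1)) (α : ℂ) (ω : Ω) :
    ℂ :=
  open Classical in
  if capacityHittingTime X ω = ⊤ then 0
  else Complex.exp (-α * (((capacityHittingTime X ω).untopD 0 : ℝ≥0) : ℝ))

/-- The analogue of `expNegHitting` for the skeleton of mesh `h`. -/
noncomputable def expNegSkeleton {Ω : Type*} {C : ℕ} (X : ℝ≥0 → Ω → Fin (C + 1)) (α : ℂ)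
    (h : ℝ≥0) : Ω → ℂ :=
  (⋃ k, firstHit X (Fin.last C) h k).indicator
    fun ω => Complex.exp (-α * ((skeletonHit X (Fin.last C) h ω * h : ℝ≥0) : ℝ))

theorem norm_exp_neg_mul_le_one {α : ℂ} (hα : 0 ≤ α.re) (x : ℝ≥0) :
    ‖Complex.exp (-α * (x : ℝ))‖ ≤ 1 := by
  rw [Complex.norm_exp]
  have : (-α * ((x : ℝ) : ℂ)).re = -(α.re * x) := by simp
  rw [this]
  exact Real.exp_le_one_iff.2 (neg_nonpos.2 (mul_nonneg hα x.2))

theorem norm_expNegHitting_le {Ω : Type*} {C : ℕ} (X : ℝ≥0 → Ω → Fin (C + 1)) {α : ℂ}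
    (hα : 0 ≤ α.re) (ω : Ω) : ‖expNegHitting X α ω‖ ≤ 1 := by
  unfold expNegHitting
  split_ifs
  · simp
  · exact norm_exp_neg_mul_le_one hα _

theorem norm_expNegSkeleton_le {Ω : Type*} {C : ℕ} (X : ℝ≥0 → Ω → Fin (C + 1)) {α : ℂ}
    (hα : 0 ≤ α.re) (h : ℝ≥0) (ω : Ω) : ‖expNegSkeleton X α h ω‖ ≤ 1 :=
  (norm_indicator_le_norm_self _ _).trans (norm_exp_neg_mul_le_one hα _)

theorem measurable_expNegSkeleton {Ω : Type*} [MeasurableSpace Ω] {C : ℕ}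
    {X : ℝ≥0 → Ω → Fin (C + 1)} (hX : ∀ t, Measurable (X t)) (α : ℂ) (h : ℝ≥0) :
    Measurable (expNegSkeleton X α h) := by
  have h1 := measurable_skeletonHit hX (Fin.last C) h
  have h2 : Measurable fun n : ℕ => Complex.exp (-α * ((n * h : ℝ≥0) : ℝ)) := measurable_from_nat
  exact (h2.comp h1).indicator (MeasurableSet.iUnion fun k => measurableSet_firstHit hX _ h k)

theorem tendsto_expNegSkeleton_mesh {Ω : Type*} {C : ℕ} {X : ℝ≥0 → Ω → Fin (C + 1)} {ω : Ω}
    (hr : ∀ t, ∀ᶠ s in 𝓝[≥] t, X s ω = X t ω) (α : ℂ) :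
    Tendsto (fun m => expNegSkeleton X α (mesh m) ω) atTop (𝓝 (expNegHitting X α ω)) := by
  by_cases hT : capacityHittingTime X ω = ⊤
  · have : ∀ h, ω ∉ ⋃ k, firstHit X (Fin.last C) h k := fun h hω => by
      obtain ⟨k, hk⟩ := mem_iUnion_firstHit.1 hω
      exact capacityHittingTime_eq_top_iff.1 hT _ hk
    simp [expNegSkeleton, expNegHitting, hT, this]
  · obtain ⟨ε, hε, H⟩ := exists_skeletonHit_mul_mem_Icc hr hT
    have hev : ∀ᶠ m in atTop, mesh m < ε := tendsto_mesh.eventually (gt_mem_nhds hε)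
    have hc : Continuous fun x : ℝ≥0 => Complex.exp (-α * ((x : ℝ) : ℂ)) := by fun_prop
    have h1 := (hc.tendsto _).comp (tendsto_skeletonHit_mul_mesh hr)
    simp only [expNegHitting, hT, if_false]
    refine h1.congr' ?_
    filter_upwards [hev] with m hm
    simp [expNegSkeleton, Set.indicator_of_mem (H _ (mesh_pos m) hm).1]

/-- The Laplace transform of the skeleton hitting time is the generating function of the first-hit
probabilities at `w = e^{-αh}`. -/
theorem integral_expNegSkeleton {Ω : Type*} [MeasurableSpace Ω] {P : Measure Ω}
    [IsFiniteMeasure P] {C : ℕ} {X : ℝ≥0 → Ω → Fin (C + 1)} (hX : ∀ t, Measurable (X t)) {α : ℂ}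
    (hα : 0 ≤ α.re) (h : ℝ≥0) :
    ∫ ω, expNegSkeleton X α h ω ∂P =
      ∑' k, (P.real (firstHit X (Fin.last C) h k) : ℂ) * Complex.exp (-α * (h : ℝ)) ^ k := by
  have hm := fun k => measurableSet_firstHit hX (Fin.last C) h k
  have hint : Integrable (expNegSkeleton X α h) P :=
    Integrable.of_bound (measurable_expNegSkeleton hX α h).aestronglyMeasurable 1
      (Eventually.of_forall fun ω => norm_expNegSkeleton_le X hα h ω)
  have h0 : ∫ ω, expNegSkeleton X α h ω ∂P =
      ∫ ω in ⋃ k, firstHit X (Fin.last C) h k, expNegSkeleton X α h ω ∂P := by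
    rw [setIntegral_eq_integral_of_forall_compl_eq_zero]
    exact fun ω hω => Set.indicator_of_notMem hω _
  rw [h0, integral_iUnion hm (pairwise_disjoint_firstHit X _ h) hint.integrableOn]
  refine tsum_congr fun k => ?_
  have : Set.EqOn (expNegSkeleton X α h) (fun _ => Complex.exp (-α * (h : ℝ)) ^ k)
      (firstHit X (Fin.last C) h k) := fun ω hω => by
    rw [expNegSkeleton, Set.indicator_of_mem (Set.mem_iUnion.2 ⟨k, hω⟩),
      skeletonHit_eq_of_mem hω, ← Complex.exp_nat_mul]
    congr 1
    push_cast
    ring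
  rw [setIntegral_congr_fun (hm k) this, setIntegral_const]
  simp

/-! ### The Laplace transform of the hitting time -/

theorem tendsto_one_sub_exp_neg_mul_div (β : ℂ) :
    Tendsto (fun h : ℝ => (1 - Complex.exp (-β * h)) / h) (𝓝[>] 0) (𝓝 β) := by
  have hd : HasDerivAt (fun h : ℝ => 1 - Complex.exp (-β * h)) β 0 := by
    have h1 : HasDerivAt (fun h : ℝ => -β * (h : ℂ)) (-β) 0 := by
      simpa using (Complex.ofRealCLM.hasDerivAt (x := (0 : ℝ))).const_mul (-β)
    simpa using h1.cexp.const_sub 1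
  have h2 := (hasDerivAt_iff_tendsto_slope.1 hd).mono_left
    (nhdsWithin_mono (0 : ℝ) fun x (hx : 0 < x) => hx.ne')
  refine h2.congr fun h => ?_
  simp [slope_def_module, div_eq_inv_mul]

theorem tendsto_one_sub_exp_div_one_sub_exp (α : ℂ) {β : ℂ} (hβ : β ≠ 0) :
    Tendsto (fun h : ℝ => (1 - Complex.exp (-α * h)) / (1 - Complex.exp (-β * h))) (𝓝[>] 0)
      (𝓝 (α / β)) := by
  refine ((tendsto_one_sub_exp_neg_mul_div α).div (tendsto_one_sub_exp_neg_mul_div β) hβ).congr' ?_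
  filter_upwards [self_mem_nhdsWithin] with h (hh : 0 < h)
  have : (h : ℂ) ≠ 0 := by exact_mod_cast hh.ne'
  simp only [Pi.div_apply]
  rw [div_div_div_cancel_right₀ this]

/-- `∑ k, C(N, k) (1 - ν) ^ k ν ^ (N - k) α / (α + k)`, the term for `k = 0` being `ν ^ N`. -/
noncomputable def returnTransform (ν : ℝ) (N : ℕ) (α : ℂ) : ℂ :=
  ∑ k ∈ Finset.range (N + 1), ((1 - ν) ^ k * ν ^ (N - k) * N.choose k : ℝ) *
    -- The value `1` is the continuous extension to `α = 0`, where division would give `0`.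
    (if k = 0 then 1 else α / (α + k))

theorem continuousAt_returnTransform (ν : ℝ) (N : ℕ) {α : ℂ} (hα : 0 ≤ α.re) :
    ContinuousAt (returnTransform ν N) α := by
  refine tendsto_finsetSum _ fun k _ => Tendsto.const_mul _ ?_
  split_ifs with hk
  · exact tendsto_const_nhds
  · refine tendsto_id.div (tendsto_id.add_const _) fun h => ?_
    have := congrArg Complex.re h
    have hk' : (0 : ℝ) < k := by exact_mod_cast Nat.pos_of_ne_zero hk
    simp at this
    linarith

theorem returnTransform_zero (ν : ℝ) (N : ℕ) : returnTransform ν N 0 = (ν ^ N : ℝ) := by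
  rw [returnTransform, Finset.sum_eq_single 0]
  · simp
  · intro k _ hk
    simp [hk]
  · simp

theorem IsEngsetFromZero.renewal {Ω : Type*} [MeasurableSpace Ω] {P : Measure Ω}
    [IsProbabilityMeasure P] {ν : ℝ} {N : ℕ} {X : ℝ≥0 → Ω → Fin (N + 1)}
    (hX : IsEngsetFromZero ν N N X P) (h : ℝ≥0) (n : ℕ) :
    (ν * (1 - Real.exp (-(h : ℝ)) ^ n)) ^ N = ∑ k ∈ Finset.range (n + 1),
      P.real (firstHit X (Fin.last N) h k) *
        (ν + (1 - ν) * Real.exp (-(h : ℝ)) ^ (n - k)) ^ N := by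
  have h1 := hX.isMarkovJumpProcess.renewal (Fin.last N) h n
  rw [hX.isMarkovJumpProcess.measureReal_of_ae_eq_zero hX.initial] at h1
  simp only [exp_smul_engsetQ_apply_last, ehrenfestTop, Fin.val_zero, Fin.val_last, Nat.sub_zero,
    Nat.sub_self, pow_zero, one_mul, mul_one] at h1
  have e : ∀ j : ℕ, Real.exp (-(j * (h : ℝ))) = Real.exp (-(h : ℝ)) ^ j := fun j => by
    rw [← Real.exp_nat_mul]; congr 1; ring
  push_cast at h1
  simpa only [e] using h1

theorem IsEngsetFromZero.norm_integral_expNegSkeleton_mul_sub_le {Ω : Type*} [MeasurableSpace Ω]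
    {P : Measure Ω} [IsProbabilityMeasure P] {ν : ℝ} (hν0 : 0 ≤ ν) (hν1 : ν ≤ 1) {N : ℕ}
    {X : ℝ≥0 → Ω → Fin (N + 1)} (hX : IsEngsetFromZero ν N N X P) {α : ℂ} (hα : 0 < α.re)
    {h : ℝ≥0} (hh : 0 < h) :
    ‖(∫ ω, expNegSkeleton X α h ω ∂P) * (∑ k ∈ Finset.range (N + 1),
        ((1 - ν) ^ k * ν ^ (N - k) * N.choose k : ℝ) *
          ((1 - Complex.exp (-α * (h : ℝ))) / (1 - Complex.exp (-(α + k) * (h : ℝ))))) -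
        (ν ^ N : ℝ)‖ ≤
      ν ^ N * N * ‖1 - Complex.exp (-α * (h : ℝ))‖ / (1 - Real.exp (-(h : ℝ))) := by
  have hh' : (0 : ℝ) < h := NNReal.coe_pos.2 hh
  have hw : ‖Complex.exp (-α * (h : ℝ))‖ < 1 := by
    rw [Complex.norm_exp, Real.exp_lt_one_iff]
    have : (-α * ((h : ℝ) : ℂ)).re = -(α.re * h) := by simp
    rw [this]
    exact neg_neg_of_pos (mul_pos hα hh')
  have key := norm_tsum_mul_sub_le_of_renewal (x := Real.exp (-(h : ℝ))) hν0 hν1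
    (Real.exp_pos _).le (Real.exp_lt_one_iff.2 (neg_neg_of_pos hh')) N
    (f := fun k => P.real (firstHit X (Fin.last N) h k))
    (fun k => by rw [abs_of_nonneg measureReal_nonneg]; exact measureReal_le_one)
    (hX.renewal h) hw
  rw [integral_expNegSkeleton hX.isMarkovJumpProcess.measurable hα.le]
  have e : ∀ k : ℕ, Complex.exp (-(α + k) * (h : ℝ)) =
      Complex.exp (-α * (h : ℝ)) * (Real.exp (-(h : ℝ)) : ℂ) ^ k := fun k => by
    rw [Complex.ofReal_exp, ← Complex.exp_nat_mul, ← Complex.exp_add]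
    congr 1
    push_cast
    ring
  simpa only [e] using key

theorem aestronglyMeasurable_expNegHitting {Ω : Type*} [MeasurableSpace Ω] {P : Measure Ω} {C : ℕ}
    {Q : Matrix (Fin (C + 1)) (Fin (C + 1)) ℝ} {X : ℝ≥0 → Ω → Fin (C + 1)}
    (hX : IsMarkovJumpProcess Q X P) (α : ℂ) : AEStronglyMeasurable (expNegHitting X α) P := by
  refine aestronglyMeasurable_of_tendsto_ae atTop
    (f := fun m => expNegSkeleton X α (mesh m))
    (fun m => (measurable_expNegSkeleton hX.measurable α _).aestronglyMeasurable) ?_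
  filter_upwards [hX.right_continuous] with ω hω using tendsto_expNegSkeleton_mesh hω α

/-- Limit of the skeleton estimate as the mesh tends to `0`: the ratios `(1 - e^{-αh}) / (1 - e^{-(α
+ k)h})` tend to `α / (α + k)`, and dominated convergence handles the integral. -/
theorem IsEngsetFromZero.norm_integral_expNegHitting_mul_sub_le_of_pos {Ω : Type*}
    [MeasurableSpace Ω]
    {P : Measure Ω} [IsProbabilityMeasure P] {ν : ℝ} (hν0 : 0 ≤ ν) (hν1 : ν ≤ 1) {N : ℕ}
    {X : ℝ≥0 → Ω → Fin (N + 1)} (hX : IsEngsetFromZero ν N N X P) {α : ℂ} (hα : 0 < α.re) :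
    ‖(∫ ω, expNegHitting X α ω ∂P) * returnTransform ν N α - (ν ^ N : ℝ)‖ ≤ ν ^ N * N * ‖α‖ := by
  have hα0 : α ≠ 0 := fun h => by simp [h] at hα
  have hαk : ∀ k : ℕ, α + k ≠ 0 := fun k h => by
    have := congrArg Complex.re h
    have hk' : (0 : ℝ) ≤ k := Nat.cast_nonneg k
    simp at this
    linarith
  have hint : Tendsto (fun m => ∫ ω, expNegSkeleton X α (mesh m) ω ∂P) atTop
      (𝓝 (∫ ω, expNegHitting X α ω ∂P)) := by
    refine tendsto_integral_of_dominated_convergence (fun _ => 1)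
      (fun m => (measurable_expNegSkeleton hX.isMarkovJumpProcess.measurable α
        _).aestronglyMeasurable) (integrable_const _)
      (fun m => Eventually.of_forall fun ω => norm_expNegSkeleton_le X hα.le _ ω) ?_
    filter_upwards [hX.isMarkovJumpProcess.right_continuous] with ω hω
      using tendsto_expNegSkeleton_mesh hω α
  have hsum : Tendsto (fun m => ∑ k ∈ Finset.range (N + 1),
        (((1 - ν) ^ k * ν ^ (N - k) * N.choose k : ℝ) : ℂ) *
          ((1 - Complex.exp (-α * (mesh m : ℝ))) / (1 - Complex.exp (-(α + k) * (mesh m : ℝ)))))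
      atTop (𝓝 (returnTransform ν N α)) := by
    refine tendsto_finsetSum _ fun k _ => Tendsto.const_mul _ ?_
    have := (tendsto_one_sub_exp_div_one_sub_exp α (hαk k)).comp tendsto_coe_mesh
    have e : (if k = 0 then 1 else α / (α + k)) = α / (α + k) := by
      split_ifs with hk
      · simp [hk, div_self hα0]
      · rfl
    rw [e]
    exact this
  have hbd : Tendsto (fun m => ν ^ N * N * ‖1 - Complex.exp (-α * (mesh m : ℝ))‖ /
      (1 - Real.exp (-(mesh m : ℝ)))) atTop (𝓝 (ν ^ N * N * ‖α‖)) := by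
    have h1 := ((tendsto_one_sub_exp_div_one_sub_exp α one_ne_zero).comp tendsto_coe_mesh).norm
    rw [div_one] at h1
    refine (h1.const_mul (ν ^ N * N)).congr fun m => ?_
    have e : (1 : ℂ) - Complex.exp (-1 * ((mesh m : ℝ) : ℂ)) =
        ((1 - Real.exp (-(mesh m : ℝ)) : ℝ) : ℂ) := by
      push_cast; simp
    have hpos : 0 ≤ 1 - Real.exp (-(mesh m : ℝ)) := by
      have : Real.exp (-(mesh m : ℝ)) ≤ 1 := Real.exp_le_one_iff.2 (neg_nonpos.2 (mesh m).2)
      linarith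
    simp only [Function.comp_apply]
    rw [e, norm_div, Complex.norm_real, Real.norm_eq_abs, abs_of_nonneg hpos, mul_div_assoc]
  exact le_of_tendsto_of_tendsto' ((hint.mul hsum).sub_const _).norm hbd fun m =>
    hX.norm_integral_expNegSkeleton_mul_sub_le hν0 hν1 hα (mesh_pos m)

/-- Characteristic functions live on `Re α = 0`, where `‖w‖ = 1` and the series argument fails; the
estimate extends there by continuity, approaching `α` from the right. -/
theorem IsEngsetFromZero.norm_integral_expNegHitting_mul_sub_le {Ω : Type*} [MeasurableSpace Ω]
    {P : Measure Ω} [IsProbabilityMeasure P] {ν : ℝ} (hν0 : 0 ≤ ν) (hν1 : ν ≤ 1) {N : ℕ}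
    {X : ℝ≥0 → Ω → Fin (N + 1)} (hX : IsEngsetFromZero ν N N X P) {α : ℂ} (hα : 0 ≤ α.re) :
    ‖(∫ ω, expNegHitting X α ω ∂P) * returnTransform ν N α - (ν ^ N : ℝ)‖ ≤ ν ^ N * N * ‖α‖ := by
  have hlim : Tendsto (fun m => α + ((mesh m : ℝ) : ℂ)) atTop (𝓝 α) := by
    have := (Complex.continuous_ofReal.tendsto 0).comp
      (tendsto_coe_mesh.mono_right nhdsWithin_le_nhds)
    simpa using this.const_add α
  have hre : ∀ m, 0 < (α + ((mesh m : ℝ) : ℂ)).re := fun m => by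
    have : (0 : ℝ) < mesh m := NNReal.coe_pos.2 (mesh_pos m)
    simp only [Complex.add_re, Complex.ofReal_re]
    linarith
  have hint : Tendsto (fun m => ∫ ω, expNegHitting X (α + ((mesh m : ℝ) : ℂ)) ω ∂P) atTop
      (𝓝 (∫ ω, expNegHitting X α ω ∂P)) := by
    refine tendsto_integral_of_dominated_convergence (fun _ => 1)
      (fun m => aestronglyMeasurable_expNegHitting hX.isMarkovJumpProcess _) (integrable_const _)
      (fun m => Eventually.of_forall fun ω => norm_expNegHitting_le X (hre m).le ω)
      (Eventually.of_forall fun ω => ?_)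
    unfold expNegHitting
    split_ifs
    · exact tendsto_const_nhds
    · have hc : Continuous fun z : ℂ =>
          Complex.exp (-z * (((capacityHittingTime X ω).untopD 0 : ℝ≥0) : ℝ)) := by fun_prop
      exact (hc.tendsto α).comp hlim
  exact le_of_tendsto_of_tendsto'
    ((hint.mul ((continuousAt_returnTransform ν N hα).tendsto.comp hlim)).sub_const _).norm
    (hlim.norm.const_mul _) fun m =>
      hX.norm_integral_expNegHitting_mul_sub_le_of_pos hν0 hν1 (hre m)

/-- At `α = 0` the error bound vanishes and `expNegHitting` is the indicator of `T < ∞`, so its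
integral is `1`. -/
theorem IsEngsetFromZero.ae_capacityHittingTime_ne_top {Ω : Type*} [MeasurableSpace Ω]
    {P : Measure Ω} [IsProbabilityMeasure P] {ν : ℝ} (hν0 : 0 < ν) (hν1 : ν ≤ 1) {N : ℕ}
    {X : ℝ≥0 → Ω → Fin (N + 1)} (hX : IsEngsetFromZero ν N N X P) :
    ∀ᵐ ω ∂P, capacityHittingTime X ω ≠ ⊤ := by
  have h := hX.norm_integral_expNegHitting_mul_sub_le hν0.le hν1 (α := 0) le_rfl
  rw [returnTransform_zero, norm_zero, mul_zero, norm_le_zero_iff, sub_eq_zero] at h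
  have h1 : ∫ ω, expNegHitting X 0 ω ∂P = 1 :=
    mul_right_cancel₀ (Complex.ofReal_ne_zero.2 (pow_pos hν0 N).ne') (h.trans (one_mul _).symm)
  have hint : Integrable (expNegHitting X 0) P :=
    Integrable.of_bound (aestronglyMeasurable_expNegHitting hX.isMarkovJumpProcess 0) 1
      (Eventually.of_forall fun ω => norm_expNegHitting_le X le_rfl ω)
  have hre : Integrable (fun ω => (expNegHitting X 0 ω).re) P := hint.re
  have h2 : ∫ ω, (1 - (expNegHitting X 0 ω).re) ∂P = 0 := by
    rw [integral_sub (integrable_const _) hre, integral_const]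
    have : ∫ ω, (expNegHitting X 0 ω).re ∂P = (∫ ω, expNegHitting X 0 ω ∂P).re := integral_re hint
    rw [this, h1]
    simp
  have h3 := (integral_eq_zero_iff_of_nonneg (fun ω => ?_) ((integrable_const 1).sub hre)).1 h2
  · filter_upwards [h3] with ω hω htop
    simp [expNegHitting, htop] at hω
  · have := (Complex.re_le_norm _).trans (norm_expNegHitting_le X (α := 0) le_rfl ω)
    simpa using this

/-! ### Inverse moments of the binomial distribution -/

/-- Absorption `(N + 1) C(N, k) = (k + 1) C(N + 1, k + 1)` turns the sum into a binomial expansion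
of order `N + 1` without its first term. -/
theorem add_one_mul_sum_binomial_div_add_one {μ ν : ℝ} (h : μ + ν = 1) (N : ℕ) :
    (N + 1) * μ * ∑ k ∈ Finset.range (N + 1), μ ^ k * ν ^ (N - k) * N.choose k * (k + 1 : ℝ)⁻¹ =
      1 - ν ^ (N + 1) := by
  have h1 := add_pow μ ν (N + 1)
  rw [h, one_pow, Finset.sum_range_succ'] at h1
  have h2 : ∑ k ∈ Finset.range (N + 1), μ ^ (k + 1) * ν ^ (N + 1 - (k + 1)) *
      ((N + 1).choose (k + 1) : ℝ) = 1 - ν ^ (N + 1) := by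
    simp at h1 ⊢
    linarith
  rw [← h2, Finset.mul_sum]
  refine Finset.sum_congr rfl fun k _ => ?_
  have hc : ((N : ℝ) + 1) * N.choose k = (N + 1).choose (k + 1) * (k + 1) := by
    exact_mod_cast Nat.add_one_mul_choose_eq N k
  rw [Nat.add_sub_add_right]
  field_simp
  linear_combination μ ^ (k + 1) * ν ^ (N - k) * hc

/-- Absorption applied twice; the two missing terms of the expansion of order `N + 2` are
nonnegative. -/
theorem mul_sum_binomial_div_le_one {μ ν : ℝ} (hμ : 0 ≤ μ) (hν : 0 ≤ ν) (h : μ + ν = 1) (N : ℕ) :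
    (N + 2) * (N + 1) * μ ^ 2 * ∑ k ∈ Finset.range (N + 1),
      μ ^ k * ν ^ (N - k) * N.choose k * ((k + 1 : ℝ) * (k + 2))⁻¹ ≤ 1 := by
  have h1 := add_pow μ ν (N + 2)
  rw [h, one_pow, Finset.sum_range_succ', Finset.sum_range_succ'] at h1
  have h2 : ∑ k ∈ Finset.range (N + 1), μ ^ (k + 1 + 1) * ν ^ (N + 2 - (k + 1 + 1)) *
      ((N + 2).choose (k + 1 + 1) : ℝ) ≤ 1 := by
    have a1 : 0 ≤ μ ^ (0 + 1) * ν ^ (N + 2 - (0 + 1)) * ((N + 2).choose (0 + 1) : ℝ) := by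
      positivity
    have a2 : 0 ≤ μ ^ 0 * ν ^ (N + 2 - 0) * ((N + 2).choose 0 : ℝ) := by positivity
    linarith
  refine le_trans (le_of_eq ?_) h2
  rw [Finset.mul_sum]
  refine Finset.sum_congr rfl fun k _ => ?_
  have hc1 : ((N : ℝ) + 1) * N.choose k = (N + 1).choose (k + 1) * (k + 1) := by
    exact_mod_cast Nat.add_one_mul_choose_eq N k
  have hc2 : ((N : ℝ) + 2) * (N + 1).choose (k + 1) = (N + 2).choose (k + 1 + 1) * (k + 2) := by
    exact_mod_cast Nat.add_one_mul_choose_eq (N + 1) (k + 1)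
  have e : N + 2 - (k + 1 + 1) = N - k := by omega
  rw [e]
  field_simp
  linear_combination μ ^ (k + 2) * ν ^ (N - k) * ((N + 2) * hc1 + (k + 1) * hc2)

/-- If `K` is binomial with parameters `N` and `μ` then `N E[1 / K; K ≥ 1]` converges to `1 / μ`. -/
theorem tendsto_mul_sum_binomial_mul_inv {μ ν : ℝ} (hμ : 0 < μ) (hν : 0 < ν) (h : μ + ν = 1) :
    Tendsto (fun N : ℕ => (N : ℝ) * ∑ k ∈ Finset.range (N + 1),
      μ ^ k * ν ^ (N - k) * N.choose k * (k : ℝ)⁻¹) atTop (𝓝 μ⁻¹) := by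
  have hν1 : ν < 1 := by linarith
  have t1 : Tendsto (fun N : ℕ => (N : ℝ) / (N + 1)) atTop (𝓝 1) :=
    tendsto_natCast_div_add_atTop 1
  have t2 : Tendsto (fun N : ℕ => ν ^ (N + 1)) atTop (𝓝 0) :=
    (tendsto_pow_atTop_nhds_zero_of_lt_one hν.le hν1).comp (tendsto_add_atTop_nat 1)
  have t3 : Tendsto (fun N : ℕ => (N : ℝ) * ν ^ N) atTop (𝓝 0) :=
    tendsto_self_mul_const_pow_of_lt_one hν.le hν1
  have t4 : Tendsto (fun N : ℕ => ((N : ℝ) + 2)⁻¹) atTop (𝓝 0) :=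
    tendsto_inv_atTop_zero.comp (tendsto_atTop_add_const_right _ _ tendsto_natCast_atTop_atTop)
  have t5 : Tendsto (fun N : ℕ => (N : ℝ) / (N + 1) * ((1 - ν ^ (N + 1)) * μ⁻¹)) atTop
      (𝓝 μ⁻¹) := by
    simpa using t1.mul ((t2.const_sub 1).mul_const μ⁻¹)
  have hlow : Tendsto (fun N : ℕ => (N : ℝ) / (N + 1) * ((1 - ν ^ (N + 1)) * μ⁻¹) - N * ν ^ N) atTop
      (𝓝 μ⁻¹) := by simpa using t5.sub t3
  have hup : Tendsto (fun N : ℕ => (N : ℝ) / (N + 1) * ((1 - ν ^ (N + 1)) * μ⁻¹) +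
      N / (N + 1) * (((N : ℝ) + 2)⁻¹ * (3 * (μ ^ 2)⁻¹))) atTop (𝓝 μ⁻¹) := by
    simpa using t5.add (t1.mul (t4.mul_const (3 * (μ ^ 2)⁻¹)))
  have s1 : ∀ N : ℕ, ∑ k ∈ Finset.range (N + 1), μ ^ k * ν ^ (N - k) * N.choose k *
      (k + 1 : ℝ)⁻¹ = (1 - ν ^ (N + 1)) * μ⁻¹ / (N + 1) := fun N => by
    rw [← add_one_mul_sum_binomial_div_add_one h N]
    field_simp
  have s2 : ∀ N : ℕ, ∑ k ∈ Finset.range (N + 1), μ ^ k * ν ^ (N - k) * N.choose k *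
      ((k + 1 : ℝ) * (k + 2))⁻¹ ≤ (μ ^ 2)⁻¹ / ((N + 1) * (N + 2)) := fun N => by
    rw [le_div_iff₀ (by positivity), ← one_div, le_div_iff₀ (by positivity)]
    refine le_trans (le_of_eq ?_) (mul_sum_binomial_div_le_one hμ.le hν.le h N)
    ring
  -- For `k ≥ 1`, `1/k` lies between `1/(k+1)` and `1/(k+1) + 3/((k+1)(k+2))`, the constant `3`
  -- giving equality at `k = 1`. Since `0⁻¹ = 0`, the lower bound must give up the term `ν ^ N` at
  -- `k = 0`.
  refine tendsto_of_tendsto_of_tendsto_of_le_of_le hlow hup (fun N => ?_) (fun N => ?_)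
  · have : ∑ k ∈ Finset.range (N + 1), (μ ^ k * ν ^ (N - k) * N.choose k * (k + 1 : ℝ)⁻¹ -
        if k = 0 then ν ^ N else 0) ≤
        ∑ k ∈ Finset.range (N + 1), μ ^ k * ν ^ (N - k) * N.choose k * (k : ℝ)⁻¹ := by
      refine Finset.sum_le_sum fun k _ => ?_
      rcases Nat.eq_zero_or_pos k with rfl | hk
      · simp
      · have hk' : (0 : ℝ) < k := by exact_mod_cast hk
        rw [if_neg hk.ne', sub_zero]
        gcongr
        linarith
    rw [Finset.sum_sub_distrib, Finset.sum_ite_eq', if_pos (by simp), s1] at this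
    calc (N : ℝ) / (N + 1) * ((1 - ν ^ (N + 1)) * μ⁻¹) - N * ν ^ N
        = N * ((1 - ν ^ (N + 1)) * μ⁻¹ / (N + 1) - ν ^ N) := by ring
      _ ≤ _ := by gcongr
  · have : ∑ k ∈ Finset.range (N + 1), μ ^ k * ν ^ (N - k) * N.choose k * (k : ℝ)⁻¹ ≤
        ∑ k ∈ Finset.range (N + 1), (μ ^ k * ν ^ (N - k) * N.choose k * (k + 1 : ℝ)⁻¹ +
          3 * (μ ^ k * ν ^ (N - k) * N.choose k * ((k + 1 : ℝ) * (k + 2))⁻¹)) := by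
      refine Finset.sum_le_sum fun k _ => ?_
      have hp : 0 ≤ μ ^ k * ν ^ (N - k) * N.choose k := by positivity
      have : (k : ℝ)⁻¹ ≤ (k + 1 : ℝ)⁻¹ + 3 * ((k + 1 : ℝ) * (k + 2))⁻¹ := by
        rcases Nat.eq_zero_or_pos k with rfl | hk
        · norm_num
        · have hk' : (1 : ℝ) ≤ k := by exact_mod_cast hk
          have hk0 : (0 : ℝ) < k := by linarith
          have e : (k + 1 : ℝ)⁻¹ + 3 * ((k + 1 : ℝ) * (k + 2))⁻¹ =
              (k + 5) / ((k + 1 : ℝ) * (k + 2)) := by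
            field_simp; ring
          rw [e, ← one_div, div_le_div_iff₀ hk0 (by positivity)]
          nlinarith
      calc _ ≤ μ ^ k * ν ^ (N - k) * N.choose k *
            ((k + 1 : ℝ)⁻¹ + 3 * ((k + 1 : ℝ) * (k + 2))⁻¹) := by gcongr
        _ = _ := by ring
    rw [Finset.sum_add_distrib, ← Finset.mul_sum, s1] at this
    calc _ ≤ (N : ℝ) * ((1 - ν ^ (N + 1)) * μ⁻¹ / (N + 1) +
          3 * ((μ ^ 2)⁻¹ / ((N + 1) * (N + 2)))) := by
          gcongr
          exact this.trans (by gcongr; exact s2 N)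
      _ = _ := by field_simp

/-! ### Convergence of characteristic functions -/

theorem charFun_expMeasure {r : ℝ} (hr : 0 < r) (t : ℝ) :
    charFun (expMeasure r) t = (1 - t / r * Complex.I)⁻¹ := by
  rw [charFun_apply_real, expMeasure, gammaMeasure,
    integral_withDensity_eq_integral_toReal_smul
      (show Measurable (gammaPDF 1 r) from (measurable_gammaPDFReal 1 r).ennreal_ofReal)
      (Eventually.of_forall fun x => ENNReal.ofReal_lt_top)]
  have e : ∀ x : ℝ, (gammaPDF 1 r x).toReal • Complex.exp (t * x * Complex.I) =
      (Set.Ici (0 : ℝ)).indicator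
        (fun x : ℝ => (r : ℂ) * Complex.exp ((t * Complex.I - r) * x)) x := fun x => by
    by_cases hx : 0 ≤ x
    · rw [Set.indicator_of_mem (Set.mem_Ici.2 hx), gammaPDF_eq, ENNReal.toReal_ofReal]
      · simp only [hx, if_true, Real.rpow_one, Real.Gamma_one, div_one, sub_self, Real.rpow_zero,
          mul_one, Complex.real_smul]
        push_cast
        rw [mul_assoc, ← Complex.exp_add]
        congr 2
        ring
      · simp [hx]; positivity
    · rw [Set.indicator_of_notMem (fun h => hx (Set.mem_Ici.1 h)), gammaPDF_eq]
      simp [hx]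
  simp_rw [e]
  have hne : (t * Complex.I - r : ℂ) ≠ 0 := fun h => by
    have := congrArg Complex.re h
    simp at this
    exact hr.ne' this
  have hrc : (r : ℂ) ≠ 0 := Complex.ofReal_ne_zero.2 hr.ne'
  rw [integral_indicator measurableSet_Ici, integral_Ici_eq_integral_Ioi, integral_const_mul,
    integral_exp_mul_complex_Ioi (by simpa using hr) 0]
  have hne' : (1 - t / r * Complex.I : ℂ) ≠ 0 := fun h => hne (by
    have : (t * Complex.I - r : ℂ) = -r * (1 - t / r * Complex.I) := by field_simp; ring
    rw [this, h, mul_zero])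
  rw [eq_comm, inv_eq_iff_eq_inv]
  simp only [Complex.ofReal_zero, mul_zero, Complex.exp_zero]
  field_simp
  ring

/-- The term `k = 0` contributes `1`. In the others `α / ν ^ N = -i t N`, and replacing `1 / (α +
k)` by `1 / k` costs at most `‖α‖`, leaving the inverse moment of the binomial law. -/
theorem tendsto_returnTransform_div_pow {ν : ℝ} (hν0 : 0 < ν) (hν1 : ν < 1) (t : ℝ) :
    Tendsto (fun N : ℕ => returnTransform ν N (-(t * (N * ν ^ N) * Complex.I)) / (ν ^ N : ℝ)) atTop
      (𝓝 (1 - t / (1 - ν : ℝ) * Complex.I)) := by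
  set p : ℕ → ℕ → ℝ := fun N k => (1 - ν) ^ k * ν ^ (N - k) * N.choose k with hp
  have hp0 : ∀ N k, 0 ≤ p N k := fun N k => by
    have : 0 ≤ 1 - ν := by linarith
    positivity
  have hp1 : ∀ N, ∑ k ∈ Finset.range (N + 1), p N k = 1 := fun N => by
    have := add_pow (1 - ν) ν N
    rw [sub_add_cancel, one_pow] at this
    exact this.symm
  set α : ℕ → ℂ := fun N => -(t * (N * ν ^ N) * Complex.I) with hα
  have hα_re : ∀ N, (α N).re = 0 := fun N => by
    have : α N = ((-(t * (N * ν ^ N)) : ℝ) : ℂ) * Complex.I := by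
      simp only [hα]; push_cast; ring
    rw [this, Complex.re_ofReal_mul]
    simp
  have hα_norm : ∀ N, ‖α N‖ = |t| * (N * ν ^ N) := fun N => by
    simp [hα, abs_of_pos hν0]
  have hαk : ∀ N k : ℕ, (k : ℝ) ≤ ‖α N + k‖ := fun N k => by
    have := Complex.abs_re_le_norm (α N + k)
    simp only [Complex.add_re, hα_re, Complex.natCast_re, zero_add, Nat.abs_cast] at this
    exact this
  -- the error made in replacing `1 / (α + k)` by `1 / k`
  set D : ℕ → ℂ := fun N => ∑ k ∈ Finset.range (N + 1), (p N k : ℂ) *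
    (if k = 0 then 0 else (α N + k)⁻¹ - (k : ℂ)⁻¹) with hD
  have hDle : ∀ N, ‖D N‖ ≤ |t| * (N * ν ^ N) := fun N => by
    calc ‖D N‖ ≤ ∑ k ∈ Finset.range (N + 1), p N k * ‖α N‖ := by
          refine norm_sum_le_of_le _ fun k _ => ?_
          rw [norm_mul, Complex.norm_real, Real.norm_eq_abs, abs_of_nonneg (hp0 N k)]
          refine mul_le_mul_of_nonneg_left ?_ (hp0 N k)
          split_ifs with hk
          · simp
          · have hk1 : (1 : ℝ) ≤ k := by exact_mod_cast Nat.one_le_iff_ne_zero.2 hk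
            have h1 : 1 ≤ ‖α N + k‖ := hk1.trans (hαk N k)
            have hk0 : (k : ℂ) ≠ 0 := Nat.cast_ne_zero.2 hk
            have h0 : α N + k ≠ 0 := norm_pos_iff.1 (by linarith)
            -- The difference is `-α / ((α + k) k)`, and both factors of the denominator have norm
            -- at least `1` because `Re α = 0`.
            rw [inv_sub_inv h0 hk0, norm_div, norm_mul, sub_add_cancel_right, norm_neg,
              Complex.norm_natCast]
            exact div_le_self (norm_nonneg _) (one_le_mul_of_one_le_of_one_le h1 hk1)
      _ = |t| * (N * ν ^ N) := by rw [← Finset.sum_mul, hp1, one_mul, hα_norm]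
  have key : ∀ N : ℕ, returnTransform ν N (α N) / (ν ^ N : ℝ) = 1 - t * Complex.I *
      (((N * ∑ k ∈ Finset.range (N + 1), p N k * (k : ℝ)⁻¹ : ℝ) : ℂ) + N * D N) := fun N => by
    have hνN : ((ν ^ N : ℝ) : ℂ) ≠ 0 := Complex.ofReal_ne_zero.2 (pow_pos hν0 N).ne'
    have h0 : returnTransform ν N (α N) = ∑ k ∈ Finset.range (N + 1),
        ((if k = 0 then ((ν ^ N : ℝ) : ℂ) else 0) + α N * ((p N k : ℂ) *
          ((k : ℂ)⁻¹ + if k = 0 then 0 else (α N + k)⁻¹ - (k : ℂ)⁻¹))) := by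
      refine Finset.sum_congr rfl fun k _ => ?_
      split_ifs with hk
      · subst hk; simp
      · simp only [hp, div_eq_mul_inv]
        ring
    rw [h0, Finset.sum_add_distrib, Finset.sum_ite_eq', if_pos (by simp), ← Finset.mul_sum]
    simp only [mul_add, Finset.sum_add_distrib]
    rw [add_div, div_self hνN, hD]
    push_cast at hνN ⊢
    simp only [hα]
    field_simp
    ring
  have hND : Tendsto (fun N : ℕ => (N : ℂ) * D N) atTop (𝓝 0) := by
    have t1 : Tendsto (fun N : ℕ => |t| * ((N : ℝ) ^ 2 * ν ^ N)) atTop (𝓝 0) := by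
      simpa using (tendsto_pow_const_mul_const_pow_of_lt_one 2 hν0.le hν1).const_mul |t|
    refine squeeze_zero_norm (fun N => ?_) t1
    rw [norm_mul, Complex.norm_natCast]
    calc (N : ℝ) * ‖D N‖ ≤ N * (|t| * (N * ν ^ N)) := by gcongr; exact hDle N
      _ = _ := by ring
  have hS := (Complex.continuous_ofReal.tendsto _).comp
    (tendsto_mul_sum_binomial_mul_inv (sub_pos.2 hν1) hν0 (sub_add_cancel 1 ν))
  have := ((hS.add hND).const_mul (t * Complex.I)).const_sub 1
  refine Tendsto.congr (fun N => (key N).symm) ?_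
  have e : (1 - t / (1 - ν : ℝ) * Complex.I : ℂ) =
      1 - t * Complex.I * (((1 - ν)⁻¹ : ℝ) + 0) := by
    push_cast
    ring
  rw [e]
  exact this

theorem tendsto_integral_expNegHitting {ν : ℝ} (hν0 : 0 < ν) (hν1 : ν < 1) {Ω : ℕ → Type*}
    [∀ N, MeasurableSpace (Ω N)] {P : ∀ N, Measure (Ω N)} [∀ N, IsProbabilityMeasure (P N)]
    {X : ∀ N, ℝ≥0 → Ω N → Fin (N + 1)} (hX : ∀ N, IsEngsetFromZero ν N N (X N) (P N)) (t : ℝ) :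
    Tendsto (fun N : ℕ => ∫ ω, expNegHitting (X N) (-(t * (N * ν ^ N) * Complex.I)) ω ∂(P N)) atTop
      (𝓝 (1 - t / (1 - ν : ℝ) * Complex.I)⁻¹) := by
  have hR := tendsto_returnTransform_div_pow hν0 hν1 t
  set φ : ℕ → ℂ := fun N => ∫ ω, expNegHitting (X N) (-(t * (N * ν ^ N) * Complex.I)) ω ∂(P N)
  set R : ℕ → ℂ := fun N =>
    returnTransform ν N (-(t * (N * ν ^ N) * Complex.I)) / (ν ^ N : ℝ) with hRdef
  have hne : (1 - t / (1 - ν : ℝ) * Complex.I : ℂ) ≠ 0 := fun h => by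
    have := congrArg Complex.re h
    rw [← Complex.ofReal_div, Complex.sub_re, Complex.re_ofReal_mul] at this
    simp at this
  -- Dividing the Laplace estimate by `ν ^ N` leaves the error `N * ‖α‖ = |t| * N ^ 2 * ν ^ N`.
  have hφR : Tendsto (fun N => φ N * R N) atTop (𝓝 1) := by
    rw [tendsto_iff_norm_sub_tendsto_zero]
    have t1 : Tendsto (fun N : ℕ => |t| * ((N : ℝ) ^ 2 * ν ^ N)) atTop (𝓝 0) := by
      simpa using (tendsto_pow_const_mul_const_pow_of_lt_one 2 hν0.le hν1).const_mul |t|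
    refine squeeze_zero (fun _ => norm_nonneg _) (fun N => ?_) t1
    have hre : (-(t * (N * ν ^ N) * Complex.I) : ℂ).re = 0 := by
      have : (-(t * (N * ν ^ N) * Complex.I) : ℂ) =
          ((-(t * (N * ν ^ N)) : ℝ) : ℂ) * Complex.I := by push_cast; ring
      rw [this, Complex.re_ofReal_mul]
      simp
    have h := (hX N).norm_integral_expNegHitting_mul_sub_le hν0.le hν1.le hre.ge
    have hpos : 0 < ν ^ N := pow_pos hν0 N
    have hνN : ((ν ^ N : ℝ) : ℂ) ≠ 0 := Complex.ofReal_ne_zero.2 hpos.ne'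
    have e : φ N * R N - 1 = (φ N * returnTransform ν N (-(t * (N * ν ^ N) * Complex.I)) -
        (ν ^ N : ℝ)) / (ν ^ N : ℝ) := by
      rw [hRdef]; field_simp
    rw [e, norm_div, Complex.norm_real, Real.norm_eq_abs, abs_of_pos hpos, div_le_iff₀ hpos]
    refine h.trans (le_of_eq ?_)
    simp [abs_of_pos hν0]
    ring
  have hdiv := hφR.div hR hne
  rw [one_div] at hdiv
  refine hdiv.congr' ?_
  filter_upwards [hR.eventually_ne hne] with N hN
  simp only [Pi.div_apply]
  exact mul_div_cancel_right₀ _ hN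

theorem mainTheorem4 (ν : ℝ) (hν0 : 0 < ν) (hν1 : ν < 1)
    {Ω : ℕ → Type*} [∀ N, MeasurableSpace (Ω N)]
    (P : ∀ N, Measure (Ω N)) [∀ N, IsProbabilityMeasure (P N)]
    (X : ∀ N, ℝ≥0 → Ω N → Fin (N + 1))
    (hX : ∀ N, IsEngsetFromZero ν N N (X N) (P N))
    {Ω' : Type*} [MeasurableSpace Ω'] (P' : Measure Ω') [IsProbabilityMeasure P']
    (Z : Ω' → ℝ) (hZ : HasLaw Z (expMeasure (1 - ν)) P') :
    (∀ N, ∀ᵐ ω ∂(P N), capacityHittingTime (X N) ω ≠ ⊤) ∧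
      TendstoInDistribution
        (fun (N : ℕ) (ω : Ω N) =>
          (N : ℝ) * ν ^ N * (((capacityHittingTime (X N) ω).untopD 0 : ℝ≥0) : ℝ))
        atTop Z P P' := by
  have hfin : ∀ N, ∀ᵐ ω ∂(P N), capacityHittingTime (X N) ω ≠ ⊤ := fun N =>
    (hX N).ae_capacityHittingTime_ne_top hν0 hν1.le
  have hm : ∀ N : ℕ, AEMeasurable (fun ω : Ω N =>
      (N : ℝ) * ν ^ N * (((capacityHittingTime (X N) ω).untopD 0 : ℝ≥0) : ℝ)) (P N) := fun N =>
    (aemeasurable_capacityHittingTime (IsEngsetFromZero.isMarkovJumpProcess (hX N))).coe_nnreal_real.const_mul _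
  refine ⟨hfin, hm, hZ.aemeasurable, ?_⟩
  -- Lévy's continuity theorem; as `T` is almost surely finite, the characteristic function at `t`
  -- is the integral of `expNegHitting` with `α = -i t N ν^N`.
  refine ProbabilityMeasure.tendsto_iff_tendsto_charFun.2 fun t => ?_
  simp only [ProbabilityMeasure.coe_mk]
  rw [hZ.map_eq, charFun_expMeasure (sub_pos.2 hν1)]
  refine (tendsto_integral_expNegHitting hν0 hν1 hX t).congr fun N => ?_
  rw [charFun_apply_real, integral_map (hm N) (by fun_prop)]
  refine integral_congr_ae ?_
  filter_upwards [hfin N] with ω hω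
  simp only [expNegHitting, hω, if_false]
  congr 1
  push_cast
  ring
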